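/- Let $d\ge 1$, let $\mathcal D\subset\mathbb R^d$ be a set of actions with $\|x\|^2\le L$ for all $x\in\mathcal D$, and let $\theta_*\in\mathbb R^d$ satisfy $\|\theta_*\|\le S$ and $\theta_*^\top x\in[-1,1]$ for all $x\in\mathcal D$. Assume that $x_*\in\mathcal D$ maximizes $\theta_*^\top x$ over $\mathcal D$. Let $R>0$ and $0<\delta<1$. In rounds $t=1,2,\dots$ the learner plays $x_t\in\mathcal D$ and observes $y_t=\theta_*^\top x_t+\eta_t$, where, for a filtration $(\mathcal F_t)$, $x_t$ is $\mathcal F_t$-measurable, $\eta_t$ is $\mathcal F_{t+1}$-measurable, $\mathbb E[\eta_t\mid\mathcal F_t]=0$ and $\mathbb E[e^{\gamma\eta_t}\mid\mathcal F_t]\le e^{\gamma^2R^2/2}$ almost surely for all $\gamma\in\mathbb R$. For a regularization parameter $\lambda$ put $$V_t=\lambda I+\sum_{i=1}^{t-1}x_ix_i^\top,\qquad \hat\theta_t=V_t^{-1}\sum_{i=1}^{t-1}y_ix_i,\qquad \sqrt{\beta_t}=R\sqrt{2\log\frac{\det(V_t)^{1/2}\det(\lambda I)^{-1/2}}{\delta}}+\lambda^{1/2}S,$$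 $$\mathcal C_t=\{\theta\in\mathbb R^d:(\theta-\hat\theta_t)^\top V_t(\theta-\hat\theta_t)\le\beta_t\}.$$ The learner follows the linear bandit algorithm that recomputes its action only when $\det(V_t)$ has more than doubled. In round $1$ it sets $\tau=1$ and takes $(\tilde\theta_1,x_1)\in\arg\max_{(\theta,x)\in\mathcal C_1\times\mathcal D}\theta^\top x$. In round $t\ge2$, if $\det(V_t)>2\det(V_\tau)$, it takes $(\tilde\theta_t,x_t)\in\arg\max_{(\theta,x)\in\mathcal C_t\times\mathcal D}\theta^\top x$ and sets $\tau=t$; otherwise it plays $x_t=x_\tau$. (The maxima are assumed to be attained; ties are broken arbitrarily.) Assume that $\lambda\ge1$ and that $\lambda\ge L$ or $\lambda^{1/2}S+R\sqrt{2\log(1/\delta)}\ge1$ (the latter holds, for example, if $S\ge 1$). Then, with probability at least $1-\delta$, the regret $R(T)=\sum_{t=1}^T(\theta_*^\top x_*-\theta_*^\top x_t)$ satisfies, for all $T\ge1$, $$R(T)\le4\sqrt{2Td\log\left(\lambda+\frac{TL}{d}\right)}\left(\lambda^{1/2}S+R\sqrt{2\log\frac1\delta+d\log\left(1+\frac{TL}{\lambda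 d}\right)}\right)+4\sqrt{d\log(T/d)},$$ where the last term is read as $0$ if $T<d$. -/

import Mathlib

open MeasureTheory

namespace LinearBandit

noncomputable section

/-- The regularized design matrix `V_t = λ I + ∑_{i=1}^{t-1} x_i x_iᵀ` (rounds are numbered from
`1`; it depends on the actions played before round `t` only). -/
def designMatrix {d : ℕ} (lam : ℝ) (x : ℕ → EuclideanSpace ℝ (Fin d)) (t : ℕ) :
    Matrix (Fin d) (Fin d) ℝ :=
  lam • (1 : Matrix (Fin d) (Fin d) ℝ)
    + ∑ i ∈ Finset.Ico 1 t, Matrix.vecMulVec (x i).ofLp (x i).ofLp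

/-- The `ℓ²`-regularized least-squares estimate `(Xᵀ X + λ I)⁻¹ Xᵀ Y`, where `X` has the rows
`x_1ᵀ, …, x_{t-1}ᵀ` and `Y = (y_1, …, y_{t-1})ᵀ`; thus `Xᵀ X + λ I = V_t` and
`Xᵀ Y = ∑_{i=1}^{t-1} y_i x_i`. -/
def leastSquares {d : ℕ} (lam : ℝ) (x : ℕ → EuclideanSpace ℝ (Fin d)) (y : ℕ → ℝ) (t : ℕ) :
    EuclideanSpace ℝ (Fin d) :=
  WithLp.toLp 2
    (Matrix.mulVec (designMatrix lam x t)⁻¹ (∑ i ∈ Finset.Ico 1 t, y i • (x i).ofLp))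

/-- `√β_t(δ) = R √(2 log (det(V_t)^{1/2} det(λ I)^{-1/2} / δ)) + λ^{1/2} S`. -/
def confRadius {d : ℕ} (lam R S δ : ℝ) (x : ℕ → EuclideanSpace ℝ (Fin d)) (t : ℕ) : ℝ :=
  R * √(2 * Real.log ((designMatrix lam x t).det ^ (1 / 2 : ℝ)
      * (lam • (1 : Matrix (Fin d) (Fin d) ℝ)).det ^ (-(1 / 2) : ℝ) / δ))
    + √lam * S

/-- The confidence ellipsoid
`C_t(δ) = {θ : (θ - θ̂_t)ᵀ V_t (θ - θ̂_t) ≤ β_t(δ)}`. -/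
def confSet {d : ℕ} (lam R S δ : ℝ) (x : ℕ → EuclideanSpace ℝ (Fin d)) (y : ℕ → ℝ) (t : ℕ) :
    Set (EuclideanSpace ℝ (Fin d)) :=
  {θ | (θ - leastSquares lam x y t).ofLp ⬝ᵥ
      Matrix.mulVec (designMatrix lam x t) (θ - leastSquares lam x y t).ofLp
        ≤ confRadius lam R S δ x t ^ 2}

/-- The value of the variable `τ` (the last round in which the action was changed) at the end of
round `t`. It is initialized to `1`, and it is set to `t` in round `t` exactly when
`det V_t > 2 det V_τ` for the current `τ`. -/
def lastUpdate {d : ℕ} (lam : ℝ) (x : ℕ → EuclideanSpace ℝ (Fin d)) : ℕ → ℕ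
  | 0 => 1
  | t + 1 =>
    if 2 * (designMatrix lam x (lastUpdate lam x t)).det < (designMatrix lam x (t + 1)).det then
      t + 1
    else lastUpdate lam x t

/-- `x` (actions) and `y` (observed rewards) form a run of the linear bandit algorithm that
recomputes its action only when `det V_t` has more than doubled since the last recomputation.
In the rounds `t` with `τ = t` (the first round, and those with `det V_t > 2 det V_τ`) the pair
`(θ̃_t, x_t)` is some maximizer of `θᵀ x` over `C_t(δ) × D`; in every round the action played is
`x_τ`. -/
def IsRun {d : ℕ} (D : Set (EuclideanSpace ℝ (Fin d))) (lam R S δ : ℝ)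
    (x : ℕ → EuclideanSpace ℝ (Fin d)) (y : ℕ → ℝ) : Prop :=
  ∀ t : ℕ, 1 ≤ t →
    (lastUpdate lam x t = t →
      ∃ θ' : EuclideanSpace ℝ (Fin d),
        (θ', x t) ∈ confSet lam R S δ x y t ×ˢ D ∧
        IsMaxOn (fun p : EuclideanSpace ℝ (Fin d) × EuclideanSpace ℝ (Fin d) =>
          inner ℝ p.1 p.2) (confSet lam R S δ x y t ×ˢ D) (θ', x t)) ∧
    x t = x (lastUpdate lam x t)

/-- The regret `R(T) = ∑_{t=1}^T (θ_*ᵀ x_* - θ_*ᵀ x_t)`. -/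
def regret {d : ℕ} (θ xopt : EuclideanSpace ℝ (Fin d)) (x : ℕ → EuclideanSpace ℝ (Fin d))
    (T : ℕ) : ℝ :=
  ∑ t ∈ Finset.Icc 1 T, (inner ℝ θ xopt - inner ℝ θ (x t))

/-- The noise `(η_t)_{t ≥ 1}` is a martingale difference sequence with respect to `ℱ` (`η_t` is
`ℱ_{t+1}`-measurable and centred given `ℱ_t`), conditionally `R`-sub-Gaussian given `ℱ_t`. -/
def IsCondSubGaussianNoise {Ω : Type*} {m : MeasurableSpace Ω} (μ : Measure Ω)
    (ℱ : Filtration ℕ m) (R : ℝ) (η : ℕ → Ω → ℝ) : Prop :=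
  ∀ t : ℕ, 1 ≤ t →
    Measurable[ℱ (t + 1)] (η t) ∧
    Integrable (η t) μ ∧
    μ[η t | ℱ t] =ᵐ[μ] 0 ∧
    ∀ γ : ℝ, Integrable (fun ω => Real.exp (γ * η t ω)) μ ∧
      μ[fun ω => Real.exp (γ * η t ω) | ℱ t] ≤ᵐ[μ] fun _ => Real.exp (γ ^ 2 * R ^ 2 / 2)

end

end LinearBandit

/-! With probability at least 1 - δ the true parameter lies in every confidence ellipsoid at once;
on that event the regret bound is deterministic.

Put ε = η/R and s_t = ∑_{i<t} ε_i x_i. The process exp(‖s_t‖²_{V_t⁻¹}/2) / √(det V_t / λ^d) is a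
nonnegative supermartingale started at 1. Its one-step factor is an average of exp(γ ε_t - γ²/2)
over a one-dimensional Gaussian γ whose mean and variance are known at time t
(`lintegral_mul_mixture_le`), so no d-dimensional integral is needed. Ville's inequality at level
1/δ controls all rounds simultaneously, and `mem_confSet` turns this control into membership.

On the good event, optimism bounds the gap of round t by the width of C_τ in the direction x_t
(`gap_le`). Lazy updating costs only a factor √2, because det(V) V⁻¹ grows in the Loewner order
while det V_t ≤ 2 det V_τ. Cauchy–Schwarz over rounds, the elliptical potential bound
`sum_min_one_le` and det V ≤ (tr V / d)^d then give `regret_le`, which is stronger than the claimed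
bound. -/

namespace LinearBandit

open Matrix

/-! ### Rank-one updates of positive definite matrices -/

section RankOneUpdate

variable {n : Type*} [Fintype n] {A : Matrix n n ℝ}

theorem dotProduct_mulVec_comm_of_isHermitian (hA : A.IsHermitian) (u v : n → ℝ) :
    u ⬝ᵥ A *ᵥ v = v ⬝ᵥ A *ᵥ u := by
  have h : Aᵀ = A := by simpa [IsHermitian, conjTranspose_eq_transpose_of_trivial] using hA
  rw [dotProduct_mulVec, ← mulVec_transpose, h, dotProduct_comm]

theorem posSemidef_cauchy_schwarz (hA : A.PosSemidef) (u v : n → ℝ) :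
    (u ⬝ᵥ A *ᵥ v) ^ 2 ≤ (u ⬝ᵥ A *ᵥ u) * (v ⬝ᵥ A *ᵥ v) := by
  classical
  have key := LinearMap.BilinForm.apply_mul_apply_le_of_forall_zero_le (Matrix.toLinearMap₂' ℝ A)
    (fun x => by
      rw [Matrix.toLinearMap₂'_apply']
      simpa using hA.dotProduct_mulVec_nonneg x) u v
  simp only [Matrix.toLinearMap₂'_apply'] at key
  rw [dotProduct_mulVec_comm_of_isHermitian hA.isHermitian v u] at key
  nlinarith [key]

theorem sqrt_dotProduct_mulVec_sub_le (hA : A.PosSemidef) (u v : n → ℝ) :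
    √((u - v) ⬝ᵥ A *ᵥ (u - v)) ≤ √(u ⬝ᵥ A *ᵥ u) + √(v ⬝ᵥ A *ᵥ v) := by
  have hu : 0 ≤ u ⬝ᵥ A *ᵥ u := by simpa using hA.dotProduct_mulVec_nonneg u
  have hv : 0 ≤ v ⬝ᵥ A *ᵥ v := by simpa using hA.dotProduct_mulVec_nonneg v
  refine Real.sqrt_le_iff.2 ⟨by positivity, ?_⟩
  have h := Real.abs_le_sqrt (posSemidef_cauchy_schwarz hA u v)
  rw [Real.sqrt_mul hu] at h
  have h2 := (abs_le.1 h).1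
  simp only [mulVec_sub, sub_dotProduct, dotProduct_sub]
  rw [dotProduct_mulVec_comm_of_isHermitian hA.isHermitian v u]
  nlinarith [Real.sq_sqrt hu, Real.sq_sqrt hv]

theorem posSemidef_vecMulVec_self (x : n → ℝ) : (vecMulVec x x).PosSemidef := by
  simpa using posSemidef_vecMulVec_self_star x

variable [DecidableEq n]

theorem isUnit_det_of_posDef (hA : A.PosDef) : IsUnit A.det := hA.det_pos.ne'.isUnit

theorem inv_dotProduct_nonneg (hA : A.PosDef) (v : n → ℝ) : 0 ≤ v ⬝ᵥ A⁻¹ *ᵥ v := by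
  simpa using hA.inv.posSemidef.dotProduct_mulVec_nonneg v

theorem det_add_vecMulVec (hA : A.PosDef) (x : n → ℝ) :
    (A + vecMulVec x x).det = A.det * (1 + x ⬝ᵥ A⁻¹ *ᵥ x) := by
  rw [vecMulVec_eq Unit, det_add_replicateCol_mul_replicateRow (isUnit_det_of_posDef hA)]
  congr 1
  rw [det_unique, Matrix.mul_assoc, ← replicateCol_mulVec]
  simp

/-- Sherman–Morrison in its least-squares form: the correction is the residual of the new
observation times a gain. It is checked by multiplying back, not by inverting. -/
theorem inv_add_vecMulVec_mulVec (hA : A.PosDef) (x s : n → ℝ) (e : ℝ) :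
    (A + vecMulVec x x)⁻¹ *ᵥ (s + e • x)
      = A⁻¹ *ᵥ s + ((e - x ⬝ᵥ A⁻¹ *ᵥ s) / (1 + x ⬝ᵥ A⁻¹ *ᵥ x)) • A⁻¹ *ᵥ x := by
  have hw := inv_dotProduct_nonneg hA x
  have hB : (A + vecMulVec x x).PosDef := hA.add_posSemidef (posSemidef_vecMulVec_self x)
  have hAA : A * A⁻¹ = 1 := mul_nonsing_inv _ (isUnit_det_of_posDef hA)
  have hBB : (A + vecMulVec x x)⁻¹ * (A + vecMulVec x x) = 1 :=
    nonsing_inv_mul _ (isUnit_det_of_posDef hB)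
  set c := (e - x ⬝ᵥ A⁻¹ *ᵥ s) / (1 + x ⬝ᵥ A⁻¹ *ᵥ x) with hc
  have h : s + e • x = (A + vecMulVec x x) *ᵥ (A⁻¹ *ᵥ s + c • A⁻¹ *ᵥ x) := by
    have hAv (v : n → ℝ) : A *ᵥ (A⁻¹ *ᵥ v) = v := by rw [mulVec_mulVec, hAA, one_mulVec]
    simp only [add_mulVec, mulVec_add, mulVec_smul, hAv, vecMulVec_mulVec]
    have : e = c + x ⬝ᵥ A⁻¹ *ᵥ s + c * (x ⬝ᵥ A⁻¹ *ᵥ x) := by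
      rw [hc]; field_simp; ring
    ext i
    simp
    linear_combination x i * this
  rw [h, mulVec_mulVec, hBB, one_mulVec]

/-- The increment is twice the exponent in `lintegral_gaussianReal_exp_quadratic`, with a = xᵀA⁻¹s
and w = xᵀA⁻¹x; this match drives the supermartingale. -/
theorem inv_add_vecMulVec_dotProduct (hA : A.PosDef) (x s : n → ℝ) (e : ℝ) :
    (s + e • x) ⬝ᵥ (A + vecMulVec x x)⁻¹ *ᵥ (s + e • x)
      = s ⬝ᵥ A⁻¹ *ᵥ s + (2 * e * (x ⬝ᵥ A⁻¹ *ᵥ s) + e ^ 2 * (x ⬝ᵥ A⁻¹ *ᵥ x)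
          - (x ⬝ᵥ A⁻¹ *ᵥ s) ^ 2) / (1 + x ⬝ᵥ A⁻¹ *ᵥ x) := by
  have hw := inv_dotProduct_nonneg hA x
  rw [inv_add_vecMulVec_mulVec hA]
  simp only [add_dotProduct, dotProduct_add, smul_dotProduct, dotProduct_smul, smul_eq_mul]
  rw [dotProduct_mulVec_comm_of_isHermitian hA.inv.isHermitian s x]
  field_simp
  ring

theorem inv_add_vecMulVec_dotProduct_le (hA : A.PosDef) (x s : n → ℝ) :
    s ⬝ᵥ (A + vecMulVec x x)⁻¹ *ᵥ s ≤ s ⬝ᵥ A⁻¹ *ᵥ s := by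
  have hw := inv_dotProduct_nonneg hA x
  have h := inv_add_vecMulVec_dotProduct hA x s 0
  simp only [zero_smul, add_zero] at h
  rw [h, add_le_iff_nonpos_right]
  apply div_nonpos_of_nonpos_of_nonneg _ (by positivity)
  nlinarith [sq_nonneg (x ⬝ᵥ A⁻¹ *ᵥ s)]

/-- The determinant gains the factor 1 + w, and by Cauchy–Schwarz for A⁻¹ the quadratic form loses
at most that factor. -/
theorem det_mul_inv_dotProduct_le (hA : A.PosDef) (x s : n → ℝ) :
    A.det * (s ⬝ᵥ A⁻¹ *ᵥ s)
      ≤ (A + vecMulVec x x).det * (s ⬝ᵥ (A + vecMulVec x x)⁻¹ *ᵥ s) := by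
  have hw := inv_dotProduct_nonneg hA x
  have h := inv_add_vecMulVec_dotProduct hA x s 0
  simp only [zero_smul, add_zero] at h
  rw [h, det_add_vecMulVec hA, mul_assoc]
  refine mul_le_mul_of_nonneg_left ?_ hA.det_pos.le
  have hcs := posSemidef_cauchy_schwarz hA.inv.posSemidef x s
  rw [mul_add, mul_div_cancel₀ _ (by positivity)]
  nlinarith

/-- AM–GM for the eigenvalues. -/
theorem det_le_trace_div_card_pow [Nonempty n] (hA : A.PosSemidef) :
    A.det ≤ (A.trace / Fintype.card n) ^ Fintype.card n := by
  have hn : (0 : ℝ) < Fintype.card n := by exact_mod_cast Fintype.card_pos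
  have h := Real.geom_mean_le_arith_mean_weighted Finset.univ
    (fun _ : n => (1 : ℝ) / Fintype.card n) hA.isHermitian.eigenvalues
    (fun _ _ => by positivity) (by simp) (fun i _ => hA.eigenvalues_nonneg i)
  rw [hA.isHermitian.det_eq_prod_eigenvalues, hA.isHermitian.trace_eq_sum_eigenvalues]
  simp only [RCLike.ofReal_real_eq_id, id_eq]
  have h0 : 0 ≤ ∏ i, hA.isHermitian.eigenvalues i :=
    Finset.prod_nonneg fun i _ => hA.eigenvalues_nonneg i
  rw [Real.finsetProd_rpow _ _ (fun i _ => hA.eigenvalues_nonneg i), ← Finset.mul_sum] at h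
  have h2 := pow_le_pow_left₀ (by positivity) h (Fintype.card n)
  rw [← Real.rpow_natCast, ← Real.rpow_mul h0, one_div_mul_cancel hn.ne', Real.rpow_one] at h2
  refine h2.trans (le_of_eq ?_)
  congr 1
  ring

end RankOneUpdate

/-! ### Determinant and inverse of the design matrix -/

section DesignMatrix

variable {d : ℕ} {lam : ℝ} (x : ℕ → EuclideanSpace ℝ (Fin d))

theorem det_smul_one_fin (lam : ℝ) :
    (lam • (1 : Matrix (Fin d) (Fin d) ℝ)).det = lam ^ d := by
  simp

theorem designMatrix_one : designMatrix lam x 1 = lam • 1 := by simp [designMatrix]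

theorem designMatrix_succ {t : ℕ} (ht : 1 ≤ t) :
    designMatrix lam x (t + 1) = designMatrix lam x t + vecMulVec (x t).ofLp (x t).ofLp := by
  simp [designMatrix, Finset.sum_Ico_succ_top ht, add_assoc]

theorem designMatrix_posDef (hlam : 0 < lam) (t : ℕ) : (designMatrix lam x t).PosDef :=
  (PosDef.one.smul hlam).add_posSemidef
    (posSemidef_sum _ fun i _ => posSemidef_vecMulVec_self (x i).ofLp)

theorem det_designMatrix_succ (hlam : 0 < lam) {t : ℕ} (ht : 1 ≤ t) :
    (designMatrix lam x (t + 1)).det = (designMatrix lam x t).det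
      * (1 + (x t).ofLp ⬝ᵥ (designMatrix lam x t)⁻¹ *ᵥ (x t).ofLp) := by
  rw [designMatrix_succ x ht, det_add_vecMulVec (designMatrix_posDef x hlam t)]

theorem det_designMatrix_mul_inv_dotProduct_mono (hlam : 0 < lam) (v : Fin d → ℝ) {s t : ℕ}
    (hs : 1 ≤ s) (hst : s ≤ t) :
    (designMatrix lam x s).det * (v ⬝ᵥ (designMatrix lam x s)⁻¹ *ᵥ v)
      ≤ (designMatrix lam x t).det * (v ⬝ᵥ (designMatrix lam x t)⁻¹ *ᵥ v) := by
  induction t, hst using Nat.le_induction with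
  | base => exact le_rfl
  | succ t hst ih =>
    rw [designMatrix_succ x (hs.trans hst)]
    exact ih.trans (det_mul_inv_dotProduct_le (designMatrix_posDef x hlam t) _ _)

theorem smul_one_inv_dotProduct (hlam : 0 < lam) (v : EuclideanSpace ℝ (Fin d)) :
    v.ofLp ⬝ᵥ (lam • (1 : Matrix (Fin d) (Fin d) ℝ))⁻¹ *ᵥ v.ofLp = ‖v‖ ^ 2 / lam := by
  have h : (lam • (1 : Matrix (Fin d) (Fin d) ℝ))⁻¹ = lam⁻¹ • 1 := by
    apply inv_eq_left_inv
    simp [smul_smul, hlam.ne']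
  rw [h, smul_mulVec, one_mulVec, dotProduct_smul, EuclideanSpace.real_norm_sq_eq]
  simp [dotProduct, sq, div_eq_inv_mul]

theorem designMatrix_inv_dotProduct_le (hlam : 0 < lam) (v : EuclideanSpace ℝ (Fin d)) {t : ℕ}
    (ht : 1 ≤ t) :
    v.ofLp ⬝ᵥ (designMatrix lam x t)⁻¹ *ᵥ v.ofLp ≤ ‖v‖ ^ 2 / lam := by
  induction t, ht using Nat.le_induction with
  | base => rw [designMatrix_one, smul_one_inv_dotProduct hlam]
  | succ t ht ih =>
    rw [designMatrix_succ x ht]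
    exact (inv_add_vecMulVec_dotProduct_le (designMatrix_posDef x hlam t) _ _).trans ih

theorem log_det_designMatrix_div (hlam : 0 < lam) (t : ℕ) :
    Real.log ((designMatrix lam x (t + 1)).det / lam ^ d)
      = ∑ i ∈ Finset.Icc 1 t,
          Real.log (1 + (x i).ofLp ⬝ᵥ (designMatrix lam x i)⁻¹ *ᵥ (x i).ofLp) := by
  induction t with
  | zero => simp [designMatrix_one, hlam.ne']
  | succ t ih =>
    have hw := inv_dotProduct_nonneg (designMatrix_posDef x hlam (t + 1)) (x (t + 1)).ofLp
    have hd := (designMatrix_posDef x hlam (t + 1)).det_pos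
    rw [Finset.sum_Icc_succ_top (by omega), ← ih, det_designMatrix_succ x hlam (by omega),
      mul_div_right_comm, Real.log_mul (by positivity) (by positivity)]

theorem det_designMatrix_le (hd : 1 ≤ d) (hlam : 0 < lam) {L : ℝ} (t : ℕ)
    (hx : ∀ i, 1 ≤ i → ‖x i‖ ^ 2 ≤ L) :
    (designMatrix lam x (t + 1)).det ≤ (lam + t * L / d) ^ d := by
  have : Nonempty (Fin d) := ⟨⟨0, hd⟩⟩
  have hd' : (0 : ℝ) < d := by exact_mod_cast hd
  have h := det_le_trace_div_card_pow (designMatrix_posDef x hlam (t + 1)).posSemidef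
  rw [Fintype.card_fin] at h
  refine h.trans ?_
  have htr : (designMatrix lam x (t + 1)).trace = lam * d + ∑ i ∈ Finset.Ico 1 (t + 1), ‖x i‖ ^ 2 := by
    simp only [designMatrix, trace_add, trace_smul, trace_one, Fintype.card_fin, trace_sum,
      trace_vecMulVec, smul_eq_mul]
    congr 1
    refine Finset.sum_congr rfl fun i _ => ?_
    rw [EuclideanSpace.real_norm_sq_eq]
    simp [dotProduct, sq]
  have hsum : ∑ i ∈ Finset.Ico 1 (t + 1), ‖x i‖ ^ 2 ≤ t * L := by
    refine (Finset.sum_le_card_nsmul _ _ L fun i hi => hx i (Finset.mem_Ico.1 hi).1).trans ?_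
    simp
  have hs0 : 0 ≤ ∑ i ∈ Finset.Ico 1 (t + 1), ‖x i‖ ^ 2 := Finset.sum_nonneg fun _ _ => by positivity
  rw [htr]
  refine pow_le_pow_left₀ (by positivity) ?_ d
  rw [add_div, mul_div_cancel_right₀ _ hd'.ne']
  gcongr

end DesignMatrix

/-! ### Ville's inequality and one-step Gaussian mixtures -/

section Mixture

open ProbabilityTheory
open scoped ENNReal

variable {Ω : Type*} {m' m : MeasurableSpace Ω} {μ : Measure Ω}

/-- Ville's maximal inequality for a nonnegative supermartingale, indexed from `1`. -/
theorem mul_measure_exists_lt_le {ℱ : Filtration ℕ m} {M : ℕ → Ω → ℝ≥0∞}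
    (hM : ∀ t, 1 ≤ t → Measurable[ℱ t] (M t))
    (hsuper : ∀ t, 1 ≤ t → ∀ s, MeasurableSet[ℱ t] s →
      ∫⁻ ω in s, M (t + 1) ω ∂μ ≤ ∫⁻ ω in s, M t ω ∂μ) (c : ℝ≥0∞) :
    c * μ {ω | ∃ t, 1 ≤ t ∧ c < M t ω} ≤ ∫⁻ ω, M 1 ω ∂μ := by
  set A : ℕ → Set Ω := fun n => {ω | ∃ t, 1 ≤ t ∧ t ≤ n ∧ c < M t ω} with hA
  have hAmono : Monotone A := fun n k hnk ω ⟨t, h1, h2, h3⟩ => ⟨t, h1, h2.trans hnk, h3⟩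
  have hAm (n : ℕ) : MeasurableSet[ℱ n] (A n) := by
    have : A n = ⋃ t ∈ Set.Icc 1 n, {ω | c < M t ω} := by
      ext ω
      simp [hA, and_assoc]
    rw [this]
    refine MeasurableSet.biUnion (Set.to_countable _) fun t ht => ?_
    exact ℱ.mono ht.2 _ (measurableSet_lt measurable_const (hM t ht.1))
  have hunion : {ω | ∃ t, 1 ≤ t ∧ c < M t ω} = ⋃ n, A n := by
    ext ω
    simp only [hA, Set.mem_ofPred_eq, Set.mem_iUnion]
    exact ⟨fun ⟨t, h1, h2⟩ => ⟨t, t, h1, le_rfl, h2⟩, fun ⟨_, t, h1, _, h2⟩ => ⟨t, h1, h2⟩⟩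
  -- On the part newly entered at time n + 1 the process exceeds c, so the mass moved out of the
  -- integral pays for the growth of c · μ(A n). This replaces a stopping time.
  have hstep (n : ℕ) : c * μ (A (n + 1)) + ∫⁻ ω in (A (n + 1))ᶜ, M (n + 1) ω ∂μ
      ≤ c * μ (A n) + ∫⁻ ω in (A n)ᶜ, M (n + 1) ω ∂μ := by
    have hd : MeasurableSet (A (n + 1) \ A n) :=
      ((ℱ.le _ _ (hAm _)).diff (ℱ.le _ _ (hAm _)))
    have hsplit : (A n)ᶜ = (A (n + 1) \ A n) ∪ (A (n + 1))ᶜ := by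
      ext ω
      have := @hAmono n (n + 1) (by omega) ω
      simp only [Set.mem_compl_iff, Set.mem_union, Set.mem_sdiff]
      tauto
    have hle : c * μ (A (n + 1) \ A n) ≤ ∫⁻ ω in A (n + 1) \ A n, M (n + 1) ω ∂μ := by
      rw [← setLIntegral_const]
      refine setLIntegral_mono' hd fun ω hω => ?_
      obtain ⟨⟨t, h1, h2, h3⟩, hn⟩ := hω
      rcases Nat.lt_or_ge n t with h | h
      · obtain rfl : t = n + 1 := by omega
        exact h3.le
      · exact absurd ⟨t, h1, h, h3⟩ hn
    rw [hsplit, lintegral_union (ℱ.le _ _ (hAm (n + 1))).compl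
      (Set.disjoint_left.2 fun ω h h' => h' h.1), ← add_assoc]
    gcongr
    rw [← Set.sdiff_union_of_subset (@hAmono n (n + 1) (by omega))]
    refine (mul_le_mul_right (measure_union_le _ _) c).trans ?_
    rw [mul_add, add_comm]
    simp only [Set.sdiff_union_of_subset (@hAmono n (n + 1) (by omega))]
    gcongr
  have hind (n : ℕ) : c * μ (A (n + 1)) + ∫⁻ ω in (A (n + 1))ᶜ, M (n + 1) ω ∂μ
      ≤ ∫⁻ ω, M 1 ω ∂μ := by
    induction n with
    | zero =>
      have h0 : A 0 = ∅ := by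
        ext ω
        simp only [hA, Set.mem_ofPred_eq, Set.mem_empty_iff_false, iff_false]
        rintro ⟨t, h1, h2, _⟩
        omega
      refine (hstep 0).trans ?_
      simp [h0]
    | succ n ih =>
      refine (hstep (n + 1)).trans (le_trans ?_ ih)
      exact add_le_add le_rfl (hsuper (n + 1) (by omega) _ (hAm (n + 1)).compl)
  rw [hunion, hAmono.measure_iUnion, ENNReal.mul_iSup]
  refine iSup_le fun n => ?_
  calc c * μ (A n) ≤ c * μ (A (n + 1)) := by
        gcongr
        exact hAmono (by omega)
    _ ≤ _ := le_self_add
    _ ≤ _ := hind n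

/-- On m'-measurable sets the measure with density f is dominated by μ. Comparing the trimmed
measures handles every `ℝ≥0∞`-valued Z with no integrability assumption. -/
theorem lintegral_mul_ofReal_le_of_condExp_le_one [IsFiniteMeasure μ] (hm : m' ≤ m) {f : Ω → ℝ}
    (hf0 : 0 ≤ f) (hfm : Measurable f) (hfi : Integrable f μ) (hf : μ[f | m'] ≤ᵐ[μ] fun _ => 1)
    {Z : Ω → ℝ≥0∞} (hZ : Measurable[m'] Z) :
    ∫⁻ ω, Z ω * ENNReal.ofReal (f ω) ∂μ ≤ ∫⁻ ω, Z ω ∂μ := by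
  have hle : (μ.withDensity fun ω => ENNReal.ofReal (f ω)).trim hm ≤ μ.trim hm := by
    refine Measure.le_iff.2 fun s hs => ?_
    rw [trim_measurableSet_eq hm hs, trim_measurableSet_eq hm hs, withDensity_apply _ (hm s hs),
      ← ofReal_integral_eq_lintegral_ofReal hfi.integrableOn (ae_of_all _ hf0),
      ← setIntegral_condExp hm hfi hs]
    refine ENNReal.ofReal_le_of_le_toReal ?_
    calc ∫ ω in s, (μ[f | m']) ω ∂μ ≤ ∫ _ in s, (1 : ℝ) ∂μ :=
          setIntegral_mono_ae integrable_condExp.integrableOn integrableOn_const hf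
      _ = (μ s).toReal := by simp [Measure.real]
  calc ∫⁻ ω, Z ω * ENNReal.ofReal (f ω) ∂μ
      = ∫⁻ ω, Z ω ∂(μ.withDensity fun ω => ENNReal.ofReal (f ω)) := by
        rw [lintegral_withDensity_eq_lintegral_mul _ hfm.ennreal_ofReal (hZ.mono hm le_rfl)]
        simp [mul_comm]
    _ = ∫⁻ ω, Z ω ∂((μ.withDensity fun ω => ENNReal.ofReal (f ω)).trim hm) :=
        (lintegral_trim hm hZ).symm
    _ ≤ ∫⁻ ω, Z ω ∂(μ.trim hm) := lintegral_mono' hle le_rfl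
    _ = ∫⁻ ω, Z ω ∂μ := lintegral_trim hm hZ

/-- `ε` is conditionally `1`-sub-Gaussian given `m'`, for deterministic exponents. -/
def CondSubGaussianOne (m' : MeasurableSpace Ω) {m : MeasurableSpace Ω} (μ : Measure Ω)
    (ε : Ω → ℝ) : Prop :=
  Measurable ε ∧ ∀ γ : ℝ, Integrable (fun ω => Real.exp (γ * ε ω)) μ ∧
    μ[fun ω => Real.exp (γ * ε ω) | m'] ≤ᵐ[μ] fun _ => Real.exp (γ ^ 2 / 2)

variable [IsFiniteMeasure μ] {ε : Ω → ℝ}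

theorem lintegral_mul_exp_const_le (hm : m' ≤ m) (hε : CondSubGaussianOne m' μ ε) (γ : ℝ)
    {Z : Ω → ℝ≥0∞} (hZ : Measurable[m'] Z) :
    ∫⁻ ω, Z ω * ENNReal.ofReal (Real.exp (γ * ε ω - γ ^ 2 / 2)) ∂μ ≤ ∫⁻ ω, Z ω ∂μ := by
  obtain ⟨hεm, hε⟩ := hε
  have hfun : (fun ω => Real.exp (γ * ε ω - γ ^ 2 / 2))
      = Real.exp (-(γ ^ 2 / 2)) • fun ω => Real.exp (γ * ε ω) := by
    ext ω
    simp [sub_eq_add_neg, Real.exp_add, mul_comm]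
  refine lintegral_mul_ofReal_le_of_condExp_le_one hm (fun ω => (Real.exp_pos _).le)
    (by fun_prop) ?_ ?_ hZ
  · rw [hfun]
    exact (hε γ).1.smul _
  · rw [hfun]
    filter_upwards [condExp_smul (μ := μ) (Real.exp (-(γ ^ 2 / 2)))
      (fun ω => Real.exp (γ * ε ω)) m', (hε γ).2] with ω h1 h2
    rw [h1, Pi.smul_apply, smul_eq_mul]
    calc Real.exp (-(γ ^ 2 / 2)) * (μ[fun ω => Real.exp (γ * ε ω) | m']) ω
        ≤ Real.exp (-(γ ^ 2 / 2)) * Real.exp (γ ^ 2 / 2) := by gcongr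
      _ = 1 := by rw [← Real.exp_add]; simp

/-- The sub-Gaussian bound has an exceptional null set for each fixed exponent. On a level set of γ
the exponent is constant, and the indicator is absorbed into Z. -/
theorem lintegral_mul_exp_simpleFunc_le (hm : m' ≤ m) (hε : CondSubGaussianOne m' μ ε)
    (γ : @SimpleFunc Ω m' ℝ) {Z : Ω → ℝ≥0∞} (hZ : Measurable[m'] Z) :
    ∫⁻ ω, Z ω * ENNReal.ofReal (Real.exp (γ ω * ε ω - γ ω ^ 2 / 2)) ∂μ ≤ ∫⁻ ω, Z ω ∂μ := by
  classical
  have hεm := hε.1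
  have hmeas (c : ℝ) : Measurable[m'] ((γ ⁻¹' {c}).indicator Z) :=
    hZ.indicator (@SimpleFunc.measurableSet_fiber _ _ m' γ c)
  have hdecomp (F : ℝ → Ω → ℝ≥0∞) (ω : Ω) :
      Z ω * F (γ ω) ω = ∑ c ∈ (@SimpleFunc.range _ _ m' γ), (γ ⁻¹' {c}).indicator Z ω * F c ω := by
    rw [Finset.sum_eq_single (γ ω)]
    · simp
    · intro c _ hc
      simp [Set.indicator, hc.symm]
    · intro h
      exact absurd (@SimpleFunc.mem_range_self _ _ m' γ ω) h
  calc ∫⁻ ω, Z ω * ENNReal.ofReal (Real.exp (γ ω * ε ω - γ ω ^ 2 / 2)) ∂μ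
      = ∑ c ∈ (@SimpleFunc.range _ _ m' γ), ∫⁻ ω, (γ ⁻¹' {c}).indicator Z ω
          * ENNReal.ofReal (Real.exp (c * ε ω - c ^ 2 / 2)) ∂μ := by
        rw [← lintegral_finsetSum]
        · exact lintegral_congr fun ω =>
            hdecomp (fun c ω => ENNReal.ofReal (Real.exp (c * ε ω - c ^ 2 / 2))) ω
        · intro c _
          exact ((hmeas c).mono hm le_rfl).mul (by fun_prop)
    _ ≤ ∑ c ∈ (@SimpleFunc.range _ _ m' γ), ∫⁻ ω, (γ ⁻¹' {c}).indicator Z ω ∂μ :=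
        Finset.sum_le_sum fun c _ => lintegral_mul_exp_const_le hm hε c (hmeas c)
    _ = ∫⁻ ω, Z ω ∂μ := by
        rw [← lintegral_finsetSum _ fun c _ => (hmeas c).mono hm le_rfl]
        exact lintegral_congr fun ω => by simpa using (hdecomp (fun _ _ => 1) ω).symm

/-- Fatou's lemma along simple approximations of γ. -/
theorem lintegral_mul_exp_le (hm : m' ≤ m) (hε : CondSubGaussianOne m' μ ε)
    {γ : Ω → ℝ} (hγ : Measurable[m'] γ) {Z : Ω → ℝ≥0∞} (hZ : Measurable[m'] Z) :
    ∫⁻ ω, Z ω * ENNReal.ofReal (Real.exp (γ ω * ε ω - γ ω ^ 2 / 2)) ∂μ ≤ ∫⁻ ω, Z ω ∂μ := by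
  have hs : StronglyMeasurable[m'] γ := hγ.stronglyMeasurable
  have hεm := hε.1
  have hlim (ω : Ω) : Filter.Tendsto
      (fun n => Z ω * ENNReal.ofReal (Real.exp (hs.approx n ω * ε ω - hs.approx n ω ^ 2 / 2)))
      Filter.atTop (nhds (Z ω * ENNReal.ofReal (Real.exp (γ ω * ε ω - γ ω ^ 2 / 2)))) := by
    have hc : Continuous fun c : ℝ => ENNReal.ofReal (Real.exp (c * ε ω - c ^ 2 / 2)) :=
      ENNReal.continuous_ofReal.comp (by fun_prop)
    -- The limit of the exponential factor is nonzero, so Z may take the value ∞.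
    refine ENNReal.Tendsto.const_mul ((hc.tendsto _).comp (hs.tendsto_approx ω))
      (Or.inl (by positivity))
  calc ∫⁻ ω, Z ω * ENNReal.ofReal (Real.exp (γ ω * ε ω - γ ω ^ 2 / 2)) ∂μ
      = ∫⁻ ω, Filter.liminf (fun n => Z ω
          * ENNReal.ofReal (Real.exp (hs.approx n ω * ε ω - hs.approx n ω ^ 2 / 2)))
          Filter.atTop ∂μ := lintegral_congr fun ω => (hlim ω).liminf_eq.symm
    _ ≤ Filter.liminf (fun n => ∫⁻ ω, Z ω
          * ENNReal.ofReal (Real.exp (hs.approx n ω * ε ω - hs.approx n ω ^ 2 / 2)) ∂μ)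
          Filter.atTop := by
        refine lintegral_liminf_le fun n => ?_
        have h1 : Measurable (hs.approx n) :=
          (@SimpleFunc.measurable _ _ m' _ (hs.approx n)).mono hm le_rfl
        exact (hZ.mono hm le_rfl).mul (by fun_prop)
    _ ≤ ∫⁻ ω, Z ω ∂μ :=
        Filter.liminf_le_of_frequently_le'
          (Filter.Frequently.of_forall fun n => lintegral_mul_exp_simpleFunc_le hm hε _ hZ)

theorem lintegral_gaussianReal_exp_quadratic (a e : ℝ) {w : ℝ} (hw : 0 ≤ w) :
    ∫⁻ g, ENNReal.ofReal (Real.exp ((a + √w * g) * e - (a + √w * g) ^ 2 / 2)) ∂(gaussianReal 0 1)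
      = ENNReal.ofReal
          (Real.exp ((2 * e * a + e ^ 2 * w - a ^ 2) / (1 + w) / 2) / √(1 + w)) := by
  set K := (2 * e * a + e ^ 2 * w - a ^ 2) / (1 + w) / 2 with hK
  -- Completing the square in g: c is the centre and K the remaining constant.
  set c := √w * (e - a) / (1 + w) with hc
  have hint : Integrable fun g : ℝ => Real.exp (-((1 + w) / 2) * (g - c) ^ 2) :=
    (integrable_exp_neg_mul_sq (by positivity : 0 < (1 + w) / 2)).comp_sub_right c
  have hval : ∫ g : ℝ, Real.exp (-((1 + w) / 2) * (g - c) ^ 2) = √(Real.pi / ((1 + w) / 2)) := by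
    rw [integral_sub_right_eq_self (fun g : ℝ => Real.exp (-((1 + w) / 2) * g ^ 2)) c,
      integral_gaussian]
  rw [gaussianReal_of_var_ne_zero _ one_ne_zero,
    lintegral_withDensity_eq_lintegral_mul _ (measurable_gaussianPDF _ _) (by fun_prop)]
  have hpt (g : ℝ) : (gaussianPDF 0 1 * fun g : ℝ =>
        ENNReal.ofReal (Real.exp ((a + √w * g) * e - (a + √w * g) ^ 2 / 2))) g
      = ENNReal.ofReal ((√(2 * Real.pi))⁻¹ * Real.exp K
          * Real.exp (-((1 + w) / 2) * (g - c) ^ 2)) := by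
    rw [Pi.mul_apply, gaussianPDF, ← ENNReal.ofReal_mul (gaussianPDFReal_nonneg _ _ _),
      gaussianPDFReal]
    congr 1
    simp only [NNReal.coe_one, mul_one, sub_zero, mul_assoc, ← Real.exp_add]
    congr 2
    rw [hK, hc]
    clear_value K c
    clear hval hint hK hc
    have hs : w = √w ^ 2 := (Real.sq_sqrt hw).symm
    have h1 : 1 + w ≠ 0 := by positivity
    generalize √w = s at *
    subst hs
    field_simp
    ring
  rw [lintegral_congr hpt, ← ofReal_integral_eq_lintegral_ofReal (hint.const_mul _)
    (ae_of_all _ fun g => by positivity), integral_const_mul, hval]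
  congr 1
  rw [show Real.pi / ((1 + w) / 2) = 2 * Real.pi / (1 + w) by field_simp,
    Real.sqrt_div (by positivity)]
  field_simp

/-- Tonelli reduces the mixture to a fixed g, where the exponent a + √w g is m'-measurable. In the
application, N(a, w) is the law of xᵀϑ for ϑ distributed as N(V⁻¹s, V⁻¹). -/
theorem lintegral_mul_mixture_le (hm : m' ≤ m) (hε : CondSubGaussianOne m' μ ε)
    {a w : Ω → ℝ} (ha : Measurable[m'] a) (hw : Measurable[m'] w) (hw0 : ∀ ω, 0 ≤ w ω)
    {Z : Ω → ℝ≥0∞} (hZ : Measurable[m'] Z) :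
    ∫⁻ ω, Z ω * ENNReal.ofReal
        (Real.exp ((2 * ε ω * a ω + ε ω ^ 2 * w ω - a ω ^ 2) / (1 + w ω) / 2) / √(1 + w ω)) ∂μ
      ≤ ∫⁻ ω, Z ω ∂μ := by
  have hεm := hε.1
  have ha' := ha.mono hm le_rfl
  have hw' := hw.mono hm le_rfl
  have hZ' := hZ.mono hm le_rfl
  have hγ (g : ℝ) : Measurable[m'] fun ω => a ω + √(w ω) * g := by fun_prop
  calc _ = ∫⁻ ω, ∫⁻ g, Z ω * ENNReal.ofReal (Real.exp ((a ω + √(w ω) * g) * ε ω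
            - (a ω + √(w ω) * g) ^ 2 / 2)) ∂(gaussianReal 0 1) ∂μ := by
        refine lintegral_congr fun ω => ?_
        rw [lintegral_const_mul _ (by fun_prop), lintegral_gaussianReal_exp_quadratic _ _ (hw0 ω)]
    _ = ∫⁻ g, ∫⁻ ω, Z ω * ENNReal.ofReal (Real.exp ((a ω + √(w ω) * g) * ε ω
            - (a ω + √(w ω) * g) ^ 2 / 2)) ∂μ ∂(gaussianReal 0 1) := by
        refine lintegral_lintegral_swap (Measurable.aemeasurable ?_)
        unfold Function.uncurry
        fun_prop
    _ ≤ ∫⁻ _, (∫⁻ ω, Z ω ∂μ) ∂(gaussianReal 0 1) :=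
        lintegral_mono fun g => lintegral_mul_exp_le hm hε (hγ g) hZ
    _ = ∫⁻ ω, Z ω ∂μ := by simp

end Mixture

/-! ### Measurability of determinants and inverses -/

section MatrixMeasurability

variable {Ω n : Type*} {_ : MeasurableSpace Ω} [Fintype n] [DecidableEq n] {A : Ω → Matrix n n ℝ}

theorem measurable_matrix_det (hA : ∀ i j, Measurable fun ω => A ω i j) :
    Measurable fun ω => (A ω).det := by
  simp only [det_apply]
  refine Finset.measurable_fun_sum _ fun σ _ => ?_
  exact (Finset.measurable_fun_prod _ fun i _ => hA _ _).const_smul _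

theorem measurable_matrix_inv_apply (hA : ∀ i j, Measurable fun ω => A ω i j) (i j : n) :
    Measurable fun ω => (A ω)⁻¹ i j := by
  simp only [inv_def, Ring.inverse_eq_inv', Matrix.smul_apply, smul_eq_mul, adjugate_apply]
  refine (measurable_matrix_det hA).inv.mul (measurable_matrix_det fun k l => ?_)
  by_cases h : k = j
  · subst h
    simp
  · simpa [updateRow_ne h] using hA k l

theorem measurable_inv_dotProduct (hA : ∀ i j, Measurable fun ω => A ω i j) {u v : Ω → n → ℝ}
    (hu : ∀ i, Measurable fun ω => u ω i) (hv : ∀ i, Measurable fun ω => v ω i) :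
    Measurable fun ω => u ω ⬝ᵥ (A ω)⁻¹ *ᵥ v ω := by
  simp only [dotProduct, mulVec]
  exact Finset.measurable_fun_sum _ fun i _ => (hu i).mul
    (Finset.measurable_fun_sum _ fun j _ => (measurable_matrix_inv_apply hA i j).mul (hv j))

end MatrixMeasurability

/-! ### The confidence ellipsoids hold uniformly in time -/

section Confidence

variable {d : ℕ} {lam : ℝ}

/-- `∑_{i=1}^{t-1} ε_i x_i`. -/
noncomputable def noiseSum (x : ℕ → EuclideanSpace ℝ (Fin d)) (ε : ℕ → ℝ) (t : ℕ) : Fin d → ℝ :=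
  ∑ i ∈ Finset.Ico 1 t, ε i • (x i).ofLp

theorem noiseSum_succ (x : ℕ → EuclideanSpace ℝ (Fin d)) (ε : ℕ → ℝ) {t : ℕ} (ht : 1 ≤ t) :
    noiseSum x ε (t + 1) = noiseSum x ε t + ε t • (x t).ofLp := by
  simp [noiseSum, Finset.sum_Ico_succ_top ht]

theorem designMatrix_mulVec (x : ℕ → EuclideanSpace ℝ (Fin d)) (θ : EuclideanSpace ℝ (Fin d))
    (t : ℕ) : designMatrix lam x t *ᵥ θ.ofLp
      = lam • θ.ofLp + ∑ i ∈ Finset.Ico 1 t, inner ℝ θ (x i) • (x i).ofLp := by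
  simp only [designMatrix, add_mulVec, smul_mulVec, one_mulVec, sum_mulVec, vecMulVec_mulVec]
  congr 1
  refine Finset.sum_congr rfl fun i _ => ?_
  ext j
  simp [EuclideanSpace.inner_eq_star_dotProduct, mul_comm]

theorem confRadius_eq (hlam : 0 < lam) {R S δ : ℝ} (hδ : 0 < δ)
    (x : ℕ → EuclideanSpace ℝ (Fin d)) (t : ℕ) :
    confRadius lam R S δ x t
      = R * √(2 * Real.log (1 / δ) + Real.log ((designMatrix lam x t).det / lam ^ d))
        + √lam * S := by
  have hdet := (designMatrix_posDef x hlam t).det_pos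
  have hl : 0 < lam ^ d := by positivity
  rw [confRadius, det_smul_one_fin, Real.log_div (by positivity) hδ.ne',
    Real.log_mul (by positivity) (by positivity), Real.log_rpow hdet, Real.log_rpow hl,
    Real.log_div hdet.ne' hl.ne', one_div δ, Real.log_inv]
  congr 3
  ring

/-- Since θ - θ̂_t = V_t⁻¹(λθ - R s_t), the triangle inequality in the V_t⁻¹-norm splits the error
into a noise part and a regularization bias; the bias is at most √λ S because V_t⁻¹ ≤ λ⁻¹ I. -/
theorem mem_confSet (hlam : 0 < lam) {R S δ : ℝ} (hR : 0 < R) (hδ : 0 < δ)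
    {x : ℕ → EuclideanSpace ℝ (Fin d)} {ε y : ℕ → ℝ} {θ : EuclideanSpace ℝ (Fin d)} (hθ : ‖θ‖ ≤ S)
    {t : ℕ} (ht : 1 ≤ t) (hy : ∀ i, y i = inner ℝ θ (x i) + R * ε i)
    (h : noiseSum x ε t ⬝ᵥ (designMatrix lam x t)⁻¹ *ᵥ noiseSum x ε t
      ≤ 2 * Real.log (1 / δ) + Real.log ((designMatrix lam x t).det / lam ^ d)) :
    θ ∈ confSet lam R S δ x y t := by
  have hV := designMatrix_posDef x hlam t
  have hV1 : (designMatrix lam x t)⁻¹ * designMatrix lam x t = 1 :=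
    nonsing_inv_mul _ (isUnit_det_of_posDef hV)
  have hV2 : designMatrix lam x t * (designMatrix lam x t)⁻¹ = 1 :=
    mul_nonsing_inv _ (isUnit_det_of_posDef hV)
  set z := lam • θ.ofLp - R • noiseSum x ε t with hz
  have hdiff : (θ - leastSquares lam x y t).ofLp = (designMatrix lam x t)⁻¹ *ᵥ z := by
    have hsum : ∑ i ∈ Finset.Ico 1 t, y i • (x i).ofLp
        = designMatrix lam x t *ᵥ θ.ofLp - z := by
      simp only [designMatrix_mulVec, hz, noiseSum, hy, add_smul, Finset.sum_add_distrib,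
        Finset.smul_sum, mul_smul]
      abel
    rw [leastSquares, hsum, mulVec_sub, mulVec_mulVec, hV1, one_mulVec]
    simp
  have hquad : (θ - leastSquares lam x y t).ofLp ⬝ᵥ
      designMatrix lam x t *ᵥ (θ - leastSquares lam x y t).ofLp
      = z ⬝ᵥ (designMatrix lam x t)⁻¹ *ᵥ z := by
    rw [hdiff, mulVec_mulVec, hV2, one_mulVec, dotProduct_comm]
  rw [confSet, Set.mem_ofPred_eq, hquad]
  refine (Real.sqrt_le_left ?_).1 ?_
  · have hS : 0 ≤ S := (norm_nonneg _).trans hθ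
    unfold confRadius
    positivity
  refine (sqrt_dotProduct_mulVec_sub_le hV.inv.posSemidef _ _).trans ?_
  rw [confRadius_eq hlam hδ, add_comm]
  simp only [mulVec_smul, dotProduct_smul, smul_dotProduct, smul_eq_mul, ← mul_assoc]
  gcongr ?_ + ?_
  · rw [Real.sqrt_mul (by positivity), Real.sqrt_mul_self hR.le]
    gcongr
  · rw [Real.sqrt_le_left (by have := (norm_nonneg _).trans hθ; positivity), mul_pow,
      Real.sq_sqrt hlam.le]
    have h1 := designMatrix_inv_dotProduct_le x hlam θ ht
    calc lam * lam * (θ.ofLp ⬝ᵥ (designMatrix lam x t)⁻¹ *ᵥ θ.ofLp)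
        ≤ lam * lam * (‖θ‖ ^ 2 / lam) := by gcongr
      _ = lam * ‖θ‖ ^ 2 := by field_simp
      _ ≤ lam * S ^ 2 := by gcongr

/-- The Gaussian mixture of the exponential supermartingales, in closed form. -/
noncomputable def mixtureProcess (lam : ℝ) (x : ℕ → EuclideanSpace ℝ (Fin d)) (ε : ℕ → ℝ)
    (t : ℕ) : ENNReal :=
  ENNReal.ofReal (Real.exp (noiseSum x ε t ⬝ᵥ (designMatrix lam x t)⁻¹ *ᵥ noiseSum x ε t / 2)
    / √((designMatrix lam x t).det / lam ^ d))

theorem mixtureProcess_one (hlam : 0 < lam) (x : ℕ → EuclideanSpace ℝ (Fin d)) (ε : ℕ → ℝ) :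
    mixtureProcess lam x ε 1 = 1 := by
  simp [mixtureProcess, noiseSum, designMatrix_one, hlam.ne']

theorem mixtureProcess_succ (hlam : 0 < lam) (x : ℕ → EuclideanSpace ℝ (Fin d)) (ε : ℕ → ℝ)
    {t : ℕ} (ht : 1 ≤ t) :
    mixtureProcess lam x ε (t + 1) = mixtureProcess lam x ε t * ENNReal.ofReal
      (Real.exp ((2 * ε t * ((x t).ofLp ⬝ᵥ (designMatrix lam x t)⁻¹ *ᵥ noiseSum x ε t)
          + ε t ^ 2 * ((x t).ofLp ⬝ᵥ (designMatrix lam x t)⁻¹ *ᵥ (x t).ofLp)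
          - ((x t).ofLp ⬝ᵥ (designMatrix lam x t)⁻¹ *ᵥ noiseSum x ε t) ^ 2)
          / (1 + (x t).ofLp ⬝ᵥ (designMatrix lam x t)⁻¹ *ᵥ (x t).ofLp) / 2)
        / √(1 + (x t).ofLp ⬝ᵥ (designMatrix lam x t)⁻¹ *ᵥ (x t).ofLp)) := by
  have hV := designMatrix_posDef x hlam t
  have hdet := hV.det_pos
  rw [mixtureProcess, mixtureProcess, ← ENNReal.ofReal_mul (by positivity),
    det_designMatrix_succ x hlam ht, noiseSum_succ x ε ht, designMatrix_succ x ht,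
    inv_add_vecMulVec_dotProduct hV, add_div, Real.exp_add, mul_div_right_comm _ _ (lam ^ d),
    Real.sqrt_mul (by positivity), mul_div_mul_comm]

theorem inv_dotProduct_le_of_mixtureProcess_le (hlam : 0 < lam) {δ : ℝ} (hδ : 0 < δ)
    {x : ℕ → EuclideanSpace ℝ (Fin d)} {ε : ℕ → ℝ} {t : ℕ}
    (h : mixtureProcess lam x ε t ≤ ENNReal.ofReal (1 / δ)) :
    noiseSum x ε t ⬝ᵥ (designMatrix lam x t)⁻¹ *ᵥ noiseSum x ε t
      ≤ 2 * Real.log (1 / δ) + Real.log ((designMatrix lam x t).det / lam ^ d) := by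
  have hdet := (designMatrix_posDef x hlam t).det_pos
  have hr : 0 < (designMatrix lam x t).det / lam ^ d := by positivity
  rw [mixtureProcess, ENNReal.ofReal_le_ofReal_iff (by positivity),
    div_le_iff₀ (Real.sqrt_pos.2 hr)] at h
  have h2 := Real.log_le_log (Real.exp_pos _) h
  rw [Real.log_exp, Real.log_mul (by positivity) (Real.sqrt_pos.2 hr).ne', Real.log_sqrt hr.le] at h2
  linarith

section Probability

variable {Ω : Type*} {m : MeasurableSpace Ω} {ℱ : Filtration ℕ m}
  {x : ℕ → Ω → EuclideanSpace ℝ (Fin d)} {ε : ℕ → Ω → ℝ}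

theorem measurable_coord {m' : MeasurableSpace Ω} {v : Ω → EuclideanSpace ℝ (Fin d)}
    (hv : Measurable v) (i : Fin d) : Measurable fun ω => v ω i :=
  (by fun_prop : Continuous fun u : EuclideanSpace ℝ (Fin d) => u i).measurable.comp hv

theorem measurable_designMatrix_apply (hx : ∀ t, 1 ≤ t → Measurable[ℱ t] (x t)) (t : ℕ)
    (i j : Fin d) : Measurable[ℱ t] fun ω => designMatrix lam (fun s => x s ω) t i j := by
  simp only [designMatrix, Matrix.add_apply, Matrix.sum_apply, vecMulVec_apply]
  refine measurable_const.add (Finset.measurable_fun_sum _ fun s hs => ?_)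
  obtain ⟨h1, h2⟩ := Finset.mem_Ico.1 hs
  have h := (hx s h1).mono (ℱ.mono h2.le) le_rfl
  exact (measurable_coord h i).mul (measurable_coord h j)

theorem measurable_noiseSum_apply (hx : ∀ t, 1 ≤ t → Measurable[ℱ t] (x t))
    (hε : ∀ t, 1 ≤ t → Measurable[ℱ (t + 1)] (ε t)) (t : ℕ) (i : Fin d) :
    Measurable[ℱ t] fun ω => noiseSum (fun s => x s ω) (fun s => ε s ω) t i := by
  simp only [noiseSum, Finset.sum_apply, Pi.smul_apply, smul_eq_mul]
  refine Finset.measurable_fun_sum _ fun s hs => ?_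
  obtain ⟨h1, h2⟩ := Finset.mem_Ico.1 hs
  exact ((hε s h1).mono (ℱ.mono h2) le_rfl).mul
    (measurable_coord ((hx s h1).mono (ℱ.mono h2.le) le_rfl) i)

theorem measurable_mixtureProcess (hx : ∀ t, 1 ≤ t → Measurable[ℱ t] (x t))
    (hε : ∀ t, 1 ≤ t → Measurable[ℱ (t + 1)] (ε t)) (t : ℕ) :
    Measurable[ℱ t] fun ω => mixtureProcess lam (fun s => x s ω) (fun s => ε s ω) t := by
  have hV := measurable_designMatrix_apply (lam := lam) hx t
  have hS := measurable_noiseSum_apply hx hε t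
  have hq := measurable_inv_dotProduct hV hS hS
  have hd := measurable_matrix_det hV
  unfold mixtureProcess
  exact (((hq.div_const 2).exp).div (hd.div_const _).sqrt).ennreal_ofReal

theorem measure_forall_inv_dotProduct_le {μ : Measure Ω} [IsProbabilityMeasure μ]
    (hlam : 0 < lam) {δ : ℝ} (hδ : 0 < δ) (hx : ∀ t, 1 ≤ t → Measurable[ℱ t] (x t))
    (hε : ∀ t, 1 ≤ t → Measurable[ℱ (t + 1)] (ε t))
    (hsub : ∀ t, 1 ≤ t → CondSubGaussianOne (ℱ t) μ (ε t)) :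
    ENNReal.ofReal (1 - δ) ≤ μ {ω | ∀ t, 1 ≤ t →
      mixtureProcess lam (fun s => x s ω) (fun s => ε s ω) t ≤ ENNReal.ofReal (1 / δ)} := by
  set M : ℕ → Ω → ENNReal := fun t ω => mixtureProcess lam (fun s => x s ω) (fun s => ε s ω) t
  have hM (t : ℕ) : Measurable[ℱ t] (M t) := measurable_mixtureProcess hx hε t
  -- The set indicator is absorbed into the past factor Z, so the mixture bound gives the
  -- supermartingale inequality on every past event.
  have hville := mul_measure_exists_lt_le (μ := μ) (fun t _ => hM t)
    (fun t ht s hs => by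
      have hV := measurable_designMatrix_apply (lam := lam) hx t
      have hS := measurable_noiseSum_apply hx hε t
      have hxt := measurable_coord (hx t ht)
      rw [← lintegral_indicator (ℱ.le t s hs), ← lintegral_indicator (ℱ.le t s hs)]
      refine le_trans (le_of_eq (lintegral_congr fun ω => ?_))
        (lintegral_mul_mixture_le (ℱ.le t) (hsub t ht) (measurable_inv_dotProduct hV hxt hS)
          (measurable_inv_dotProduct hV hxt hxt)
          (fun ω => inv_dotProduct_nonneg (designMatrix_posDef _ hlam t) _)
          ((hM t).indicator hs))
      by_cases hω : ω ∈ s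
      · simp only [Set.indicator_of_mem hω]
        exact mixtureProcess_succ hlam _ _ ht
      · simp [Set.indicator_of_notMem hω]) (ENNReal.ofReal (1 / δ))
  have hM1 : ∫⁻ ω, M 1 ω ∂μ = 1 := by
    simp [M, mixtureProcess_one hlam]
  rw [hM1] at hville
  have hbad : μ {ω | ∃ t, 1 ≤ t ∧ ENNReal.ofReal (1 / δ) < M t ω} ≤ ENNReal.ofReal δ := by
    have hc : ENNReal.ofReal (1 / δ) = (ENNReal.ofReal δ)⁻¹ := by
      rw [one_div, ENNReal.ofReal_inv_of_pos hδ]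
    rw [hc, mul_comm, ← div_eq_mul_inv] at hville
    rw [hc]
    simpa using (ENNReal.div_le_iff (by simpa using hδ) ENNReal.ofReal_ne_top).1 hville
  have hmeas : MeasurableSet {ω | ∃ t, 1 ≤ t ∧ ENNReal.ofReal (1 / δ) < M t ω} := by
    have : {ω | ∃ t, 1 ≤ t ∧ ENNReal.ofReal (1 / δ) < M t ω}
        = ⋃ t ∈ Set.Ici 1, {ω | ENNReal.ofReal (1 / δ) < M t ω} := by
      ext ω
      simp
    rw [this]
    exact MeasurableSet.biUnion (Set.to_countable _) fun t _ =>
      measurableSet_lt measurable_const ((hM t).mono (ℱ.le t) le_rfl)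
  have hcompl : {ω | ∀ t, 1 ≤ t → M t ω ≤ ENNReal.ofReal (1 / δ)}
      = {ω | ∃ t, 1 ≤ t ∧ ENNReal.ofReal (1 / δ) < M t ω}ᶜ := by
    ext ω
    simp
  rw [hcompl, prob_compl_eq_one_sub hmeas, ENNReal.ofReal_sub _ hδ.le, ENNReal.ofReal_one]
  exact tsub_le_tsub_left hbad 1

theorem condSubGaussianOne_div {μ : Measure Ω} {R : ℝ} (hR : 0 < R) {η : ℕ → Ω → ℝ}
    (hη : IsCondSubGaussianNoise μ ℱ R η) {t : ℕ} (ht : 1 ≤ t) :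
    CondSubGaussianOne (ℱ t) μ fun ω => η t ω / R := by
  obtain ⟨h1, _, _, h4⟩ := hη t ht
  refine ⟨(h1.mono (ℱ.le _) le_rfl).div_const R, fun γ => ?_⟩
  have h := h4 (γ / R)
  have hfun : (fun ω => Real.exp (γ * (η t ω / R))) = fun ω => Real.exp (γ / R * η t ω) := by
    ext ω
    congr 1
    ring
  rwa [hfun, show γ ^ 2 / 2 = (γ / R) ^ 2 * R ^ 2 / 2 by field_simp]

end Probability

end Confidence

/-! ### Deterministic regret analysis on the good event -/

section Regret

variable {d : ℕ} {lam : ℝ}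

/-- Cauchy–Schwarz in the V-inner product against V⁻¹a. -/
theorem abs_inner_sub_leastSquares_le (hlam : 0 < lam) {R S δ : ℝ} (hR : 0 ≤ R) (hS : 0 ≤ S)
    {x : ℕ → EuclideanSpace ℝ (Fin d)} {y : ℕ → ℝ} {t : ℕ} {θ : EuclideanSpace ℝ (Fin d)}
    (hθ : θ ∈ confSet lam R S δ x y t) (a : EuclideanSpace ℝ (Fin d)) :
    |inner ℝ (θ - leastSquares lam x y t) a|
      ≤ confRadius lam R S δ x t * √(a.ofLp ⬝ᵥ (designMatrix lam x t)⁻¹ *ᵥ a.ofLp) := by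
  have hV := designMatrix_posDef x hlam t
  have hVi : designMatrix lam x t *ᵥ ((designMatrix lam x t)⁻¹ *ᵥ a.ofLp) = a.ofLp := by
    rw [mulVec_mulVec, mul_nonsing_inv _ (isUnit_det_of_posDef hV), one_mulVec]
  set v := θ - leastSquares lam x y t with hv
  have hcs := posSemidef_cauchy_schwarz hV.posSemidef v.ofLp
    ((designMatrix lam x t)⁻¹ *ᵥ a.ofLp)
  have hinner : inner ℝ v a = v.ofLp ⬝ᵥ a.ofLp := by
    simp [EuclideanSpace.inner_eq_star_dotProduct, dotProduct_comm]
  rw [hVi, dotProduct_comm (_ *ᵥ _) a.ofLp] at hcs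
  have hrad : 0 ≤ confRadius lam R S δ x t := by
    unfold confRadius
    positivity
  have hq := inv_dotProduct_nonneg hV a.ofLp
  rw [hinner]
  refine abs_le_of_sq_le_sq ?_ (by positivity)
  rw [mul_pow, Real.sq_sqrt hq]
  exact hcs.trans (mul_le_mul_of_nonneg_right hθ hq)

theorem one_le_lastUpdate (x : ℕ → EuclideanSpace ℝ (Fin d)) (t : ℕ) :
    1 ≤ lastUpdate lam x t := by
  induction t with
  | zero => simp [lastUpdate]
  | succ t ih =>
    rw [lastUpdate]
    split_ifs <;> omega

/-- The initial value 1 survives round 1: the test there compares det V_1 with its own double and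
fails. -/
theorem lastUpdate_one (hlam : 0 < lam) (x : ℕ → EuclideanSpace ℝ (Fin d)) :
    lastUpdate lam x 1 = 1 := by
  have := (designMatrix_posDef x hlam 1).det_pos
  simp [lastUpdate]

theorem lastUpdate_le (hlam : 0 < lam) (x : ℕ → EuclideanSpace ℝ (Fin d)) {t : ℕ} (ht : 1 ≤ t) :
    lastUpdate lam x t ≤ t := by
  induction t, ht using Nat.le_induction with
  | base => exact (lastUpdate_one hlam x).le
  | succ t ht ih =>
    rw [lastUpdate]
    split_ifs <;> omega

/-- Ensures that the action was really optimized in round τ, so that the maximizer clause of `IsRun`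
applies there. -/
theorem lastUpdate_lastUpdate (hlam : 0 < lam) (x : ℕ → EuclideanSpace ℝ (Fin d)) (t : ℕ) :
    lastUpdate lam x (lastUpdate lam x t) = lastUpdate lam x t := by
  induction t with
  | zero => exact lastUpdate_one hlam x
  | succ t ih =>
    by_cases h : 2 * (designMatrix lam x (lastUpdate lam x t)).det
        < (designMatrix lam x (t + 1)).det
    · have h1 : lastUpdate lam x (t + 1) = t + 1 := by rw [lastUpdate, if_pos h]
      rw [h1, h1]
    · have h1 : lastUpdate lam x (t + 1) = lastUpdate lam x t := by rw [lastUpdate, if_neg h]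
      rw [h1, ih]

theorem det_designMatrix_le_two_mul (hlam : 0 < lam) (x : ℕ → EuclideanSpace ℝ (Fin d)) {t : ℕ}
    (ht : 1 ≤ t) :
    (designMatrix lam x t).det ≤ 2 * (designMatrix lam x (lastUpdate lam x t)).det := by
  obtain ⟨t, rfl⟩ := Nat.exists_eq_add_of_le' ht
  have := (designMatrix_posDef x hlam (t + 1)).det_pos
  rw [lastUpdate]
  split_ifs with h
  · linarith
  · exact not_lt.1 h

theorem inv_dotProduct_lastUpdate_le (hlam : 0 < lam) (x : ℕ → EuclideanSpace ℝ (Fin d)) {t : ℕ}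
    (ht : 1 ≤ t) (v : Fin d → ℝ) :
    v ⬝ᵥ (designMatrix lam x (lastUpdate lam x t))⁻¹ *ᵥ v
      ≤ 2 * (v ⬝ᵥ (designMatrix lam x t)⁻¹ *ᵥ v) := by
  have h := det_designMatrix_mul_inv_dotProduct_mono x hlam v (one_le_lastUpdate (lam := lam) x t)
    (lastUpdate_le hlam x ht)
  have h2 := det_designMatrix_le_two_mul hlam x ht
  have hpos := (designMatrix_posDef x hlam (lastUpdate lam x t)).det_pos
  have hq := inv_dotProduct_nonneg (designMatrix_posDef x hlam t) v
  refine le_of_mul_le_mul_left ?_ hpos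
  nlinarith [mul_le_mul_of_nonneg_right h2 hq]

/-- Optimism: θ and the optimistic θ' both lie in C_τ, and x_t = x_τ, so the gap is at most ⟨θ' - θ,
x_t⟩. Passing through θ̂_τ costs the factor 2, and replacing V_τ⁻¹ by V_t⁻¹ costs √2. -/
theorem gap_le (hlam : 0 < lam) {R S δ : ℝ} (hR : 0 ≤ R) (hS : 0 ≤ S)
    {D : Set (EuclideanSpace ℝ (Fin d))} {x : ℕ → EuclideanSpace ℝ (Fin d)} {y : ℕ → ℝ}
    (hrun : IsRun D lam R S δ x y) {θ xopt : EuclideanSpace ℝ (Fin d)} (hxopt : xopt ∈ D)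
    {t : ℕ} (ht : 1 ≤ t) (hθ : θ ∈ confSet lam R S δ x y (lastUpdate lam x t)) :
    inner ℝ θ xopt - inner ℝ θ (x t) ≤ 2 * √2 * confRadius lam R S δ x (lastUpdate lam x t)
      * √((x t).ofLp ⬝ᵥ (designMatrix lam x t)⁻¹ *ᵥ (x t).ofLp) := by
  have hτ := one_le_lastUpdate (lam := lam) x t
  obtain ⟨θ', hmem, hmax⟩ := (hrun _ hτ).1 (lastUpdate_lastUpdate hlam x t)
  rw [← (hrun t ht).2] at hmem hmax
  have hopt : inner ℝ θ xopt ≤ inner ℝ θ' (x t) := hmax (Set.mk_mem_prod hθ hxopt)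
  have h1 := (abs_le.1 (abs_inner_sub_leastSquares_le hlam hR hS hmem.1 (x t))).2
  have h2 := (abs_le.1 (abs_inner_sub_leastSquares_le hlam hR hS hθ (x t))).1
  rw [inner_sub_left] at h1 h2
  have hrad : 0 ≤ confRadius lam R S δ x (lastUpdate lam x t) := by
    unfold confRadius
    positivity
  have hs := Real.sqrt_le_sqrt (inv_dotProduct_lastUpdate_le hlam x ht (x t).ofLp)
  rw [Real.sqrt_mul zero_le_two] at hs
  nlinarith [mul_le_mul_of_nonneg_left hs hrad]

theorem mem_of_isRun (hlam : 0 < lam) {R S δ : ℝ}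
    {D : Set (EuclideanSpace ℝ (Fin d))} {x : ℕ → EuclideanSpace ℝ (Fin d)} {y : ℕ → ℝ}
    (hrun : IsRun D lam R S δ x y) {t : ℕ} (ht : 1 ≤ t) : x t ∈ D := by
  obtain ⟨_, hmem, _⟩ := (hrun _ (one_le_lastUpdate (lam := lam) x t)).1
    (lastUpdate_lastUpdate hlam x t)
  rw [(hrun t ht).2]
  exact hmem.2

theorem log_det_designMatrix_div_le (hd : 1 ≤ d) (hlam : 0 < lam) {L : ℝ} (hL : 0 ≤ L)
    {x : ℕ → EuclideanSpace ℝ (Fin d)} (hx : ∀ i, 1 ≤ i → ‖x i‖ ^ 2 ≤ L) {s T : ℕ} (hs : 1 ≤ s)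
    (hsT : s ≤ T + 1) :
    Real.log ((designMatrix lam x s).det / lam ^ d) ≤ d * Real.log (1 + T * L / (lam * d)) := by
  obtain ⟨s, rfl⟩ := Nat.exists_eq_add_of_le' hs
  have hd' : (0 : ℝ) < d := by exact_mod_cast hd
  have hpos := (designMatrix_posDef x hlam (s + 1)).det_pos
  have hsT' : (s : ℝ) ≤ T := by exact_mod_cast (by omega : s ≤ T)
  rw [← Real.log_pow]
  refine Real.log_le_log (by positivity) ?_
  rw [div_le_iff₀ (by positivity), ← mul_pow]
  refine (det_designMatrix_le x hd hlam s hx).trans (pow_le_pow_left₀ (by positivity) ?_ d)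
  calc lam + s * L / d ≤ lam + T * L / d := by gcongr
    _ = (1 + T * L / (lam * d)) * lam := by field_simp

theorem min_one_le_two_mul_log {w : ℝ} (hw : 0 ≤ w) : min w 1 ≤ 2 * Real.log (1 + w) := by
  have hm : 0 ≤ min w 1 := le_min hw zero_le_one
  -- With u = min(w, 1): log(1 + u) ≥ u/(1 + u) ≥ u/2, as u ≤ 1.
  have h1 : 1 - (1 + min w 1)⁻¹ ≤ Real.log (1 + min w 1) :=
    Real.one_sub_inv_le_log_of_pos (by positivity)
  have h2 : Real.log (1 + min w 1) ≤ Real.log (1 + w) :=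
    Real.log_le_log (by positivity) (by gcongr; exact min_le_left _ _)
  have h3 : min w 1 / 2 ≤ 1 - (1 + min w 1)⁻¹ := by
    have : 1 - (1 + min w 1)⁻¹ = min w 1 / (1 + min w 1) := by field_simp; ring
    rw [this]
    gcongr
    linarith [min_le_right w 1]
  linarith

theorem sum_min_one_le (hlam : 0 < lam) (x : ℕ → EuclideanSpace ℝ (Fin d)) (T : ℕ) :
    ∑ t ∈ Finset.Icc 1 T, min ((x t).ofLp ⬝ᵥ (designMatrix lam x t)⁻¹ *ᵥ (x t).ofLp) 1
      ≤ 2 * Real.log ((designMatrix lam x (T + 1)).det / lam ^ d) := by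
  rw [log_det_designMatrix_div x hlam, Finset.mul_sum]
  exact Finset.sum_le_sum fun t _ =>
    min_one_le_two_mul_log (inv_dotProduct_nonneg (designMatrix_posDef x hlam t) _)

theorem regret_le (hd : 1 ≤ d) (hlam : 0 < lam) {L R S δ : ℝ} (hL : 0 ≤ L) (hR : 0 ≤ R)
    (hS : 0 ≤ S) (hδ0 : 0 < δ) (hδ1 : δ < 1)
    (hscale : L ≤ lam ∨ 1 ≤ √lam * S + R * √(2 * Real.log (1 / δ)))
    {D : Set (EuclideanSpace ℝ (Fin d))} {θ xopt : EuclideanSpace ℝ (Fin d)}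
    (hDL : ∀ a ∈ D, ‖a‖ ^ 2 ≤ L) (hDθ : ∀ a ∈ D, inner ℝ θ a ∈ Set.Icc (-1 : ℝ) 1)
    (hxopt : xopt ∈ D) {x : ℕ → EuclideanSpace ℝ (Fin d)} {y : ℕ → ℝ}
    (hrun : IsRun D lam R S δ x y) (hθ : ∀ t, 1 ≤ t → θ ∈ confSet lam R S δ x y t) (T : ℕ) :
    regret θ xopt x T ≤ 4 * √(T * (d * Real.log (1 + T * L / (lam * d))))
      * (√lam * S + R * √(2 * Real.log (1 / δ) + d * Real.log (1 + T * L / (lam * d)))) := by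
  have hxL (i : ℕ) (hi : 1 ≤ i) : ‖x i‖ ^ 2 ≤ L := hDL _ (mem_of_isRun hlam hrun hi)
  set ℓ := d * Real.log (1 + T * L / (lam * d)) with hℓ
  set B := √lam * S + R * √(2 * Real.log (1 / δ) + ℓ) with hB
  have hℓ0 : 0 ≤ ℓ := mul_nonneg (Nat.cast_nonneg _)
    (Real.log_nonneg (le_add_of_nonneg_right (by positivity)))
  have hB0 : 0 ≤ B := by positivity
  set w : ℕ → ℝ := fun t => (x t).ofLp ⬝ᵥ (designMatrix lam x t)⁻¹ *ᵥ (x t).ofLp with hw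
  have hw0 (t : ℕ) : 0 ≤ w t := inv_dotProduct_nonneg (designMatrix_posDef x hlam t) _
  have hm0 (t : ℕ) : 0 ≤ min (w t) 1 := le_min (hw0 t) zero_le_one
  have hgap (t : ℕ) (ht : t ∈ Finset.Icc 1 T) :
      inner ℝ θ xopt - inner ℝ θ (x t) ≤ 2 * √2 * B * √(min (w t) 1) := by
    obtain ⟨h1, h2⟩ := Finset.mem_Icc.1 ht
    have hτ := one_le_lastUpdate (lam := lam) x t
    have hτt := lastUpdate_le hlam x h1
    have hrad : confRadius lam R S δ x (lastUpdate lam x t) ≤ B := by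
      rw [confRadius_eq hlam hδ0, hB, add_comm]
      gcongr
      exact log_det_designMatrix_div_le hd hlam hL hxL hτ (by omega)
    have hg := gap_le hlam hR hS hrun hxopt h1 (hθ _ hτ)
    rcases le_total (w t) 1 with hle | hge
    · rw [min_eq_left hle]
      refine hg.trans ?_
      gcongr
    · rw [min_eq_right hge, Real.sqrt_one, mul_one]
      -- Truncating the width at 1 is harmless for either reason: L ≤ λ forces w t ≤ 1, while B ≥ 1
      -- makes the right side exceed 2, the largest possible gap.
      rcases hscale with hs | hs
      · have hwt : w t ≤ 1 := by
          refine (designMatrix_inv_dotProduct_le x hlam (x t) h1).trans ?_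
          rw [div_le_one hlam]
          exact (hxL t h1).trans hs
        have hw1 : √(w t) = 1 := by rw [le_antisymm hwt hge, Real.sqrt_one]
        refine hg.trans ?_
        change _ * √(w t) ≤ _
        rw [hw1, mul_one]
        gcongr
      · have hB1 : 1 ≤ B := by
          refine hs.trans ?_
          rw [hB]
          gcongr
          linarith
        have h3 := (hDθ _ hxopt).2
        have h4 := (hDθ _ (mem_of_isRun hlam hrun h1)).1
        have h5 : 1 ≤ √2 := Real.one_le_sqrt.2 one_le_two
        nlinarith
  -- Cauchy–Schwarz over the T rounds; the potential bound's 2 contributes the second √2 in the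
  -- final constant 4.
  have hsum : ∑ t ∈ Finset.Icc 1 T, √(min (w t) 1) ≤ √(T * (2 * ℓ)) := by
    refine Real.le_sqrt_of_sq_le ?_
    refine (sq_sum_le_card_mul_sum_sq (s := Finset.Icc 1 T)).trans ?_
    simp only [Nat.card_Icc, add_tsub_cancel_right, Real.sq_sqrt (hm0 _)]
    gcongr
    refine (sum_min_one_le hlam x T).trans ?_
    gcongr
    exact log_det_designMatrix_div_le hd hlam hL hxL (by omega) le_rfl
  calc regret θ xopt x T ≤ ∑ t ∈ Finset.Icc 1 T, 2 * √2 * B * √(min (w t) 1) :=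
        Finset.sum_le_sum hgap
    _ = 2 * √2 * B * ∑ t ∈ Finset.Icc 1 T, √(min (w t) 1) := by rw [Finset.mul_sum]
    _ ≤ 2 * √2 * B * √(T * (2 * ℓ)) := by gcongr
    _ = 4 * √(T * ℓ) * B := by
        rw [mul_left_comm (T : ℝ) 2 ℓ, Real.sqrt_mul zero_le_two]
        linear_combination 2 * B * √(T * ℓ) * Real.mul_self_sqrt zero_le_two

end Regret

end LinearBandit

theorem mainTheorem8 {Ω : Type*} {m : MeasurableSpace Ω} (μ : Measure Ω) [IsProbabilityMeasure μ]
    (ℱ : Filtration ℕ m) (d : ℕ) (hd : 1 ≤ d)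
    (D : Set (EuclideanSpace ℝ (Fin d))) (θstar xopt : EuclideanSpace ℝ (Fin d))
    (lam L S R δ : ℝ)
    (hR : 0 < R) (hδ0 : 0 < δ) (hδ1 : δ < 1)
    (hlam : 1 ≤ lam)
    (hscale : L ≤ lam ∨ 1 ≤ √lam * S + R * √(2 * Real.log (1 / δ)))
    (hDL : ∀ a ∈ D, ‖a‖ ^ 2 ≤ L)
    (hDθ : ∀ a ∈ D, inner ℝ θstar a ∈ Set.Icc (-1 : ℝ) 1)
    (hθ : ‖θstar‖ ≤ S)
    (hxopt : xopt ∈ D) (hopt : ∀ a ∈ D, inner ℝ θstar a ≤ inner ℝ θstar xopt)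
    (x : ℕ → Ω → EuclideanSpace ℝ (Fin d)) (η : ℕ → Ω → ℝ)
    (hx : ∀ t : ℕ, 1 ≤ t → Measurable[ℱ t] (x t))
    (hη : LinearBandit.IsCondSubGaussianNoise μ ℱ R η)
    (hrun : ∀ ω, LinearBandit.IsRun D lam R S δ (fun t => x t ω)
      (fun t => inner ℝ θstar (x t ω) + η t ω)) :
    ENNReal.ofReal (1 - δ) ≤
      μ {ω | ∀ T : ℕ, 1 ≤ T →
        LinearBandit.regret θstar xopt (fun t => x t ω) T ≤
          4 * √(2 * T * d * Real.log (lam + T * L / d))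
              * (√lam * S
                  + R * √(2 * Real.log (1 / δ) + d * Real.log (1 + T * L / (lam * d))))
            + 4 * √(d * Real.log (T / d))} := by
  have hlam0 : 0 < lam := zero_lt_one.trans_le hlam
  have hS : 0 ≤ S := (norm_nonneg _).trans hθ
  have hL : 0 ≤ L := (sq_nonneg _).trans (hDL _ hxopt)
  have hd' : (0 : ℝ) < d := by exact_mod_cast hd
  refine (LinearBandit.measure_forall_inv_dotProduct_le (μ := μ) (ε := fun t ω => η t ω / R)
    hlam0 hδ0 hx (fun t ht => (hη t ht).1.div_const R)
    (fun t ht => LinearBandit.condSubGaussianOne_div hR hη ht)).trans (measure_mono ?_)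
  intro ω hω T _
  have hmem (t : ℕ) (ht : 1 ≤ t) := LinearBandit.mem_confSet hlam0 hR hδ0 hθ ht
    (y := fun t => inner ℝ θstar (x t ω) + η t ω) (ε := fun t => η t ω / R)
    (fun i => by rw [mul_div_cancel₀ _ hR.ne'])
    (LinearBandit.inv_dotProduct_le_of_mixtureProcess_le hlam0 hδ0 (hω t ht))
  -- The additive term is pure slack: `√` is nonnegative, and it vanishes on negative arguments,
  -- which covers T < d.
  refine (LinearBandit.regret_le hd hlam0 hL hR.le hS hδ0 hδ1 hscale hDL hDθ hxopt (hrun ω)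
    hmem T).trans (le_add_of_le_of_nonneg ?_ (by positivity))
  have hlog0 : 0 ≤ Real.log (lam + T * L / d) :=
    Real.log_nonneg (hlam.trans (le_add_of_nonneg_right (by positivity)))
  have hlog : Real.log (1 + T * L / (lam * d)) ≤ Real.log (lam + T * L / d) := by
    refine Real.log_le_log (by positivity) ?_
    gcongr
    exact le_mul_of_one_le_left hd'.le hlam
  have hT : (0 : ℝ) ≤ T * d := by positivity
  refine mul_le_mul_of_nonneg_right ?_ (by positivity)
  gcongr 4 * √?_
  -- λ ≥ 1 gave the comparison of logarithms; the factor 2 under the target's root is not needed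
  -- beyond that.
  nlinarith [mul_le_mul_of_nonneg_left hlog hT, mul_nonneg hT hlog0]
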